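/- **Setting.** Let $\mathcal H_p,\mathcal H_d,\mathcal H_v$ be real Hilbert spaces, $T:\mathcal H_p\to\mathcal H_v$ and $A:\mathcal H_p\to\mathcal H_d$ bounded linear operators, and $b\in\mathcal H_d$. $\Gamma_0(\mathcal H)$ denotes the set of proper convex lower semicontinuous functions $\mathcal H\to\mathbb R\cup\{+\infty\}$. Let $f,h:\mathcal H_p\to\mathbb R\cup\{+\infty\}$, let $g\in\Gamma_0(\mathcal H_v)$, and put $\operatorname{dom}\phi=\{\phi<+\infty\}$ and $\mathcal C=\operatorname{dom}h$. The Lagrangian of the problem $\min\{f(x)+g(Tx)+h(x): Ax=b\}$ is $\mathcal L(x,\mu)=f(x)+g(Tx)+h(x)+\langle\mu,Ax-b\rangle$. **Assumptions on the problem.** - (A.1) $f,\ g\circ T,\ h\in\Gamma_0(\mathcal H_p)$. - (A.2) The pair $(f,\mathcal C)$ is $(F,\zeta)$-smooth for some $F:\mathcal H_p\to\mathbb R\cup\{+\infty\}$ and $\zeta:\,]0,1]\to\mathbb R_+$. This means: $\mathcal C\subset\operatorname{dom}f$, and there is an open set $\mathcal C_0$ with $\mathcal C\subset\mathcal C_0\subset\operatorname{int}(\operatorname{dom}F)$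 such that $F$ and $f$ are (finite and) differentiable on $\mathcal C_0$, $F-f$ is convex on $\mathcal C_0$ (along every segment contained in $\mathcal C_0$), and for some $K\in\mathbb R$ one has $D_F(x+\gamma(s-x),x)\le K\zeta(\gamma)$ for all $x,s\in\mathcal C$, $\gamma\in\,]0,1]$, where $D_F(z,x)=F(z)-F(x)-\langle\nabla F(x),z-x\rangle$. - (A.3) $\mathcal C$ is weakly compact. - (A.4) $\partial g(Tx)\neq\emptyset$ for every $x\in\mathcal C$, and $\sup_{x\in\mathcal C}\|[\partial g(Tx)]^0\|<\infty$, where $[\partial g(v)]^0$ is the element of minimal norm of $\partial g(v)$. - (A.6) $\mathcal L$ has a saddle point: there is $(x^\star,\mu^\star)\in\mathcal H_p\times\mathcal H_d$ with $\mathcal L(x^\star,\mu)\le\mathcal L(x^\star,\mu^\star)\le\mathcal L(x,\mu^\star)$ for all $(x,\mu)\in\mathcal H_p\times\mathcal H_d$. - (A.7) $\operatorname{ran}(A)$ is closed. - (A.8) One of the following holds: (a) $A^{-1}(b)\cap\operatorname{int}(\operatorname{dom}(g\circ T))\cap\operatorname{int}(\mathcal C)\ne\emptyset$; (b) $\mathcal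 H_p$ and $\mathcal H_d$ are finite dimensional, $A^{-1}(b)\cap\operatorname{ri}(\operatorname{dom}(g\circ T))\cap\operatorname{ri}(\mathcal C)\neq\emptyset$, and $\operatorname{ran}(A^*)\cap V^\perp=\{0\}$, where $V$ is the linear subspace parallel to the affine hull of $\operatorname{dom}(g\circ T)\cap\mathcal C$. **Algorithm (CGALP).** Given $x_0\in\mathcal C$, $\mu_0\in\operatorname{ran}(A)$ and real sequences $(\gamma_k),(\beta_k),(\theta_k),(\rho_k)$, iterate for $k=0,1,2,\dots$ $$\begin{aligned} y_k&=\operatorname{prox}_{\beta_k g}(Tx_k)=\operatorname*{argmin}_{v}\{\beta_k g(v)+\tfrac12\|Tx_k-v\|^2\},\\ z_k&=\nabla f(x_k)+\tfrac1{\beta_k}T^*(Tx_k-y_k)+A^*\mu_k+\rho_kA^*(Ax_k-b),\\ s_k&\in\operatorname*{Argmin}_{s\in\mathcal H_p}\{h(s)+\langle z_k,s\rangle\},\\ x_{k+1}&=x_k-\gamma_k(x_k-s_k),\qquad \mu_{k+1}=\mu_k+\theta_k(Ax_{k+1}-b). \end{aligned}$$ **Assumptions on the parameters.** - (P.1) $\gamma_k\in\,]0,1]$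 and $\beta_k>0$ for all $k$, and $\sum_k\zeta(\gamma_k)<\infty$, $\sum_k\gamma_k^2/\beta_k<\infty$, $\sum_k\gamma_k\beta_k<\infty$. - (P.2) $\sum_k\gamma_k=\infty$. - (P.3) $(\beta_k)$ is non-increasing and converges to $0$. - (P.4) $(\rho_k)$ is nonnegative and non-decreasing, and $0<\underline\rho=\inf_k\rho_k\le\sup_k\rho_k<\infty$. - (P.5) There are constants $\underline M,\overline M>0$ with $\underline M\le\gamma_k/\gamma_{k+1}\le\overline M$ for all $k$. - (P.6) $\theta_k=\gamma_k/c$ for all $k$, for some $c>0$ with $\overline M/c-\underline\rho/2<0$. **Lemma 4.9 (dual multiplier boundedness).** Under (A.1)–(A.4), (A.6)–(A.8) and (P.1)–(P.6), the sequence of dual iterates $(\mu_k)$ generated by CGALP is bounded in $\mathcal H_d$. -/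

import Mathlib

open Set Filter Topology
open scoped RealInnerProductSpace

noncomputable section

namespace CGALP

section Convex

variable {H : Type*} [NormedAddCommGroup H] [InnerProductSpace ℝ H]

/-- The effective domain `{x | φ x < +∞}` of an extended-real-valued function. -/
def dom (φ : H → EReal) : Set H := {x | φ x < ⊤}

/-- The class `Γ₀(H)`: functions `H → ℝ ∪ {+∞}` that are proper, convex (convex epigraph) and lower
semicontinuous. -/
structure IsGamma0 (φ : H → EReal) : Prop where
  ne_bot : ∀ x, φ x ≠ ⊥
  proper : (dom φ).Nonempty
  convex : Convex ℝ {p : H × ℝ | φ p.1 ≤ (p.2 : EReal)}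
  lsc : LowerSemicontinuous φ

/-- The subdifferential `∂φ(x) = {u | ∀ y, φ(y) ≥ φ(x) + ⟨u, y - x⟩}`. -/
def subdiff (φ : H → EReal) (x : H) : Set H :=
  {u | ∀ y, φ x + ((⟪u, y - x⟫ : ℝ) : EReal) ≤ φ y}

/-- `dom(∂φ)`, the set of points at which the subdifferential is nonempty. -/
def domSubdiff (φ : H → EReal) : Set H := {x | (subdiff φ x).Nonempty}

/-- `u` is the minimal norm selection `[∂φ(x)]⁰`. -/
def IsMinNormSelection (φ : H → EReal) (x u : H) : Prop :=
  u ∈ subdiff φ x ∧ ∀ v ∈ subdiff φ x, ‖u‖ ≤ ‖v‖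

/-- `p = prox_φ(x)`: `p` minimizes `y ↦ φ(y) + ½‖x - y‖²`. -/
def IsProx (φ : H → EReal) (x p : H) : Prop :=
  ∀ y, φ p + (((1 / 2) * ‖x - p‖ ^ 2 : ℝ) : EReal) ≤ φ y + (((1 / 2) * ‖x - y‖ ^ 2 : ℝ) : EReal)

/-- The gradient at `x` of an extended-real-valued function, meaningful where the function is finite
near `x` and differentiable at `x`. -/
def grad [CompleteSpace H] (φ : H → EReal) (x : H) : H := gradient (fun y => (φ y).toReal) x

/-- The Bregman divergence `D_G(z, x) = G(z) - G(x) - ⟨∇G(x), z - x⟩`. It is used for `x` in an open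
set on which `G` is finite and differentiable; it is `+∞` when `G z = +∞`. -/
def bregman [CompleteSpace H] (G : H → EReal) (z x : H) : EReal :=
  G z - G x - ((⟪grad G x, z - x⟫ : ℝ) : EReal)

/-- The pair `(φ, C)` is `(G, ζ)`-smooth, for `φ, G : H → ℝ ∪ {+∞}`, `C ⊆ dom φ` and
`ζ : ]0,1] → ℝ₊` (only the values of `ζ` on `]0,1]` matter). Since the open set `C₀` need not be a
convex set, convexity of `G - φ` on `C₀` means convexity along every segment contained in `C₀`. The
last clause says that the supremum of `D_G(z, x) / ζ(γ)` over `x, s ∈ C`, `γ ∈ ]0,1]`,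
`z = x + γ (s - x)`, is finite. -/
def IsSmoothPair [CompleteSpace H] (φ : H → EReal) (C : Set H) (G : H → EReal) (ζ : ℝ → ℝ) :
    Prop :=
  (∀ x, φ x ≠ ⊥) ∧ (∀ x, G x ≠ ⊥) ∧ C ⊆ dom φ ∧ (∀ t ∈ Ioc (0 : ℝ) 1, 0 ≤ ζ t) ∧
  ∃ C₀ : Set H, IsOpen C₀ ∧ C ⊆ C₀ ∧ C₀ ⊆ interior (dom G) ∧ C₀ ⊆ dom φ ∧
    (∀ x ∈ C₀, DifferentiableAt ℝ (fun y => (G y).toReal) x) ∧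
    (∀ x ∈ C₀, DifferentiableAt ℝ (fun y => (φ y).toReal) x) ∧
    (∀ x y, segment ℝ x y ⊆ C₀ →
      ConvexOn ℝ (segment ℝ x y) (fun w => (G w).toReal - (φ w).toReal)) ∧
    ∃ K : ℝ, ∀ x ∈ C, ∀ s ∈ C, ∀ γ ∈ Ioc (0 : ℝ) 1,
      bregman G (x + γ • (s - x)) x ≤ ((K * ζ γ : ℝ) : EReal)

end Convex

section Problem

variable {Hp Hd Hv : Type*}
  [NormedAddCommGroup Hp] [InnerProductSpace ℝ Hp]
  [NormedAddCommGroup Hd] [InnerProductSpace ℝ Hd]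
  [NormedAddCommGroup Hv] [InnerProductSpace ℝ Hv]

/-- The Lagrangian `L(x, μ) = f(x) + g(Tx) + h(x) + ⟨μ, Ax - b⟩`. -/
def lagrangian (f : Hp → EReal) (g : Hv → EReal) (h : Hp → EReal)
    (T : Hp →L[ℝ] Hv) (A : Hp →L[ℝ] Hd) (b : Hd) (x : Hp) (μ : Hd) : EReal :=
  f x + g (T x) + h x + ((⟪μ, A x - b⟫ : ℝ) : EReal)

/-- `(xs, μs)` is a saddle point of the Lagrangian. -/
def IsSaddlePoint (f : Hp → EReal) (g : Hv → EReal) (h : Hp → EReal)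
    (T : Hp →L[ℝ] Hv) (A : Hp →L[ℝ] Hd) (b : Hd) (xs : Hp) (μs : Hd) : Prop :=
  ∀ x μ, lagrangian f g h T A b xs μ ≤ lagrangian f g h T A b xs μs ∧
    lagrangian f g h T A b xs μs ≤ lagrangian f g h T A b x μs

/-- The interior qualification condition
`A⁻¹(b) ∩ int(dom(g ∘ T)) ∩ int(dom h) ≠ ∅`. -/
def InteriorCondition (g : Hv → EReal) (h : Hp → EReal)
    (T : Hp →L[ℝ] Hv) (A : Hp →L[ℝ] Hd) (b : Hd) : Prop :=
  (A ⁻¹' {b} ∩ interior (dom fun x => g (T x)) ∩ interior (dom h)).Nonempty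

/-- The finite-dimensional qualification condition: the primal and dual spaces are
finite-dimensional, `A⁻¹(b) ∩ ri(dom(g ∘ T)) ∩ ri(dom h) ≠ ∅`, and
`ran(A*) ∩ LinHull(dom(g ∘ T) ∩ dom h)^⊥ = {0}`, where `LinHull(S)` is the linear subspace parallel
to the affine hull of `S`. -/
def RelativeInteriorCondition [CompleteSpace Hp] [CompleteSpace Hd]
    (g : Hv → EReal) (h : Hp → EReal)
    (T : Hp →L[ℝ] Hv) (A : Hp →L[ℝ] Hd) (b : Hd) : Prop :=
  FiniteDimensional ℝ Hp ∧ FiniteDimensional ℝ Hd ∧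
  (A ⁻¹' {b} ∩ intrinsicInterior ℝ (dom fun x => g (T x)) ∩
    intrinsicInterior ℝ (dom h)).Nonempty ∧
  (range (ContinuousLinearMap.adjoint A) : Set Hp) ∩
    ((vectorSpan ℝ ((dom fun x => g (T x)) ∩ dom h))ᗮ : Submodule ℝ Hp) = {0}

/-- The sequences `x, μ, y, z, s` form a run of the CGALP algorithm with step sizes `γ`, smoothing
parameters `β`, dual step sizes `θ` and penalization parameters `ρ`. Any minimizer may be chosen
as `s k`. -/
structure IsRun [CompleteSpace Hp] [CompleteSpace Hd] [CompleteSpace Hv]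
    (f : Hp → EReal) (g : Hv → EReal) (h : Hp → EReal)
    (T : Hp →L[ℝ] Hv) (A : Hp →L[ℝ] Hd) (b : Hd) (γ β θ ρ : ℕ → ℝ)
    (x : ℕ → Hp) (μ : ℕ → Hd) (y : ℕ → Hv) (z s : ℕ → Hp) : Prop where
  x_zero : x 0 ∈ dom h
  μ_zero : μ 0 ∈ range A
  y_step : ∀ k, IsProx (fun v => (β k : EReal) * g v) (T (x k)) (y k)
  z_step : ∀ k, z k = grad f (x k)
    + (β k)⁻¹ • ContinuousLinearMap.adjoint T (T (x k) - y k)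
    + ContinuousLinearMap.adjoint A (μ k)
    + ρ k • ContinuousLinearMap.adjoint A (A (x k) - b)
  s_step : ∀ k w, h (s k) + ((⟪z k, s k⟫ : ℝ) : EReal) ≤ h w + ((⟪z k, w⟫ : ℝ) : EReal)
  x_step : ∀ k, x (k + 1) = x k - γ k • (x k - s k)
  μ_step : ∀ k, μ (k + 1) = μ k + θ k • (A (x (k + 1)) - b)

end Problem

end CGALP

end

namespace CGALP

/-! ### Convex analysis: subgradients, proximal points, relative smoothness. -/

section Convex

variable {H : Type*} [NormedAddCommGroup H] [InnerProductSpace ℝ H]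

/-! Write `q w = A w - b`, `Ψ = f + g ∘ T + h`, and let `Q k` be the infimum over `dom h` of the
augmented Lagrangian `Ψ w + ⟪μ k, q w⟫ + ρ k / 2 * ‖q w‖ ^ 2`. The heart of the proof is a lower
bound on `Q k` uniform in `k`, obtained in `exists_lower_bound_augmented_lagrangian`.

One conditional gradient step moves the smoothed augmented Lagrangian by `γ k` times a gap towards
any competitor `w`, up to summable errors (`IsRun.augmented_lagrangian_step`). Because the penalty
is quadratic, the gap contains an extra `-ρ k / 2 * ‖q w - q (x k)‖ ^ 2`. With short dual steps this
term absorbs the increase caused by updating the multiplier, so the primal value minus twice `Q`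
grows only by summable amounts. The primal value is itself at least `Q` minus the smoothing error,
hence `Q` is bounded below.

The qualification condition turns this into weak boundedness: each direction `w` of the range of `A`
is a positive multiple of `q v` for some `v` in `dom h`, and the bound at `v` bounds `⟪μ k, w⟫`
below. Using `w` and `-w`, the uniform boundedness principle on the closed range, which contains
every `μ k`, finishes the proof. -/

theorem IsGamma0.coe_toReal {φ : H → EReal} (hφ : IsGamma0 φ) {x : H} (hx : x ∈ dom φ) :
    ((φ x).toReal : EReal) = φ x :=
  EReal.coe_toReal (LT.lt.ne (show φ x < ⊤ from hx)) (hφ.ne_bot x)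

theorem IsGamma0.segment_le {φ : H → EReal} (hφ : IsGamma0 φ) {x y : H} (hx : x ∈ dom φ)
    (hy : y ∈ dom φ) {t : ℝ} (ht : t ∈ Icc (0 : ℝ) 1) :
    x + t • (y - x) ∈ dom φ ∧
      (φ (x + t • (y - x))).toReal ≤ (1 - t) * (φ x).toReal + t * (φ y).toReal := by
  have h := hφ.convex (x := (x, (φ x).toReal)) (by simp [hφ.coe_toReal hx])
    (y := (y, (φ y).toReal)) (by simp [hφ.coe_toReal hy])
    (sub_nonneg.2 ht.2) ht.1 (by ring)
  have e : (1 - t) • x + t • y = x + t • (y - x) := by module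
  simp only [Prod.smul_mk, Prod.mk_add_mk, mem_ofPred_eq, smul_eq_mul, e] at h
  have hd : x + t • (y - x) ∈ dom φ := h.trans_lt (EReal.coe_lt_top _)
  refine ⟨hd, ?_⟩
  rw [← hφ.coe_toReal hd] at h
  exact_mod_cast h

theorem IsGamma0.convex_dom {φ : H → EReal} (hφ : IsGamma0 φ) : Convex ℝ (dom φ) := by
  rw [convex_iff_forall_pos]
  intro x hx y hy a b ha hb hab
  have := (hφ.segment_le hx hy (t := b) ⟨hb.le, by linarith⟩).1
  have e : a • x + b • y = x + b • (y - x) := by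
    rw [show a = 1 - b by linarith]; module
  rwa [e]

/-- The gradient inequality along a segment on which the function lies below its chord. -/
theorem inner_gradient_le [CompleteSpace H] {φ : H → ℝ} {x w : H} (hd : DifferentiableAt ℝ φ x)
    (hc : ∀ t ∈ Ioc (0 : ℝ) 1, φ (x + t • (w - x)) ≤ (1 - t) * φ x + t * φ w) :
    φ x + ⟪gradient φ x, w - x⟫ ≤ φ w := by
  have h1 : HasDerivAt (fun t : ℝ => φ (x + t • (w - x))) ⟪gradient φ x, w - x⟫ 0 := by
    have hg := hd.hasGradientAt.hasFDerivAt
    have hl : HasDerivAt (fun t : ℝ => x + t • (w - x)) (w - x) 0 := by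
      simpa using ((hasDerivAt_id (0 : ℝ)).smul_const (w - x)).const_add x
    have := HasFDerivAt.comp_hasDerivAt (f := fun t : ℝ => x + t • (w - x)) (0 : ℝ)
      (by simpa using hg) hl
    simpa [Function.comp_def] using this
  have h2 := h1.tendsto_slope_zero_right
  have h3 : ⟪gradient φ x, w - x⟫ ≤ φ w - φ x := by
    refine le_of_tendsto h2 ?_
    filter_upwards [Ioc_mem_nhdsGT (zero_lt_one' ℝ)] with t ht
    have := hc t ht
    simp only [zero_add, zero_smul, add_zero, smul_eq_mul]
    rw [inv_mul_le_iff₀ ht.1]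
    linarith
  linarith

theorem IsGamma0.inner_grad_le [CompleteSpace H] {φ : H → EReal} (hφ : IsGamma0 φ) {x w : H}
    (hx : x ∈ dom φ) (hw : w ∈ dom φ) (hd : DifferentiableAt ℝ (fun y => (φ y).toReal) x) :
    (φ x).toReal + ⟪grad φ x, w - x⟫ ≤ (φ w).toReal :=
  inner_gradient_le (φ := fun y => (φ y).toReal) hd fun t ht =>
    (hφ.segment_le hx hw (t := t) ⟨ht.1.le, ht.2⟩).2

theorem IsGamma0.mem_dom_of_mem_subdiff {φ : H → EReal} (hφ : IsGamma0 φ) {x u : H}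
    (hu : u ∈ subdiff φ x) : x ∈ dom φ := by
  obtain ⟨y, hy⟩ := hφ.proper
  refine (lt_top_iff_ne_top (α := EReal)).2 fun hx => ?_
  have := hu y
  rw [hx, EReal.top_add_coe, top_le_iff] at this
  exact LT.lt.ne (show φ y < ⊤ from hy) this

theorem IsGamma0.mem_subdiff_iff {φ : H → EReal} (hφ : IsGamma0 φ) {x u : H} (hx : x ∈ dom φ) :
    u ∈ subdiff φ x ↔ ∀ y ∈ dom φ, (φ x).toReal + ⟪u, y - x⟫ ≤ (φ y).toReal := by
  refine forall_congr' fun y => ?_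
  by_cases hy : y ∈ dom φ
  · rw [← hφ.coe_toReal hx, ← hφ.coe_toReal hy]
    simp only [hy, true_imp_iff, EReal.toReal_coe]
    exact_mod_cast Iff.rfl
  · have : φ y = ⊤ := by simpa [dom] using hy
    simp [hy, this]

/-- The subdifferential is an intersection of closed half-spaces, so the origin has a projection
onto it. This gives the norm bound on minimal selections an element to act on. -/
theorem IsGamma0.exists_isMinNormSelection [CompleteSpace H] {φ : H → EReal} (hφ : IsGamma0 φ)
    {x : H} (hx : x ∈ domSubdiff φ) : ∃ u, IsMinNormSelection φ x u := by
  have hxd : x ∈ dom φ := hφ.mem_dom_of_mem_subdiff hx.some_mem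
  have he : subdiff φ x =
      ⋂ y ∈ dom φ, {u | ⟪u, y - x⟫ ≤ (φ y).toReal - (φ x).toReal} := by
    ext u
    rw [hφ.mem_subdiff_iff hxd]
    simp only [mem_iInter, mem_ofPred_eq]
    exact forall₂_congr fun y _ => ⟨fun h => by linarith, fun h => by linarith⟩
  have hcl : IsClosed (subdiff φ x) := by
    rw [he]
    exact isClosed_biInter fun y _ => isClosed_le (by fun_prop) continuous_const
  have hcv : Convex ℝ (subdiff φ x) := by
    rw [he]
    refine convex_iInter₂ fun y _ => convex_halfSpace_le ?_ _
    exact ⟨fun u v => inner_add_left _ _ _, fun c u => by simp [inner_smul_left]⟩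
  obtain ⟨u, hu, hmin⟩ := exists_norm_eq_iInf_of_complete_convex hx hcl.isComplete hcv 0
  refine ⟨u, hu, fun v hv => ?_⟩
  have hb : BddBelow (range fun w : subdiff φ x => ‖(0 : H) - w‖) :=
    ⟨0, by rintro _ ⟨w, rfl⟩; exact norm_nonneg _⟩
  have := ciInf_le hb ⟨v, hv⟩
  rw [← hmin] at this
  simpa using this

/-- A proximal point lies in the domain and satisfies the proximal optimality condition. -/
theorem IsGamma0.prox_spec {φ : H → EReal} (hφ : IsGamma0 φ) {β : ℝ} (hβ : 0 < β) {x p : H}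
    (hp : IsProx (fun v => (β : EReal) * φ v) x p) :
    p ∈ dom φ ∧ β⁻¹ • (x - p) ∈ subdiff φ p := by
  have hpd : p ∈ dom φ := by
    obtain ⟨y, hy⟩ := hφ.proper
    refine (lt_top_iff_ne_top (α := EReal)).2 fun h => ?_
    have := hp y
    simp only at this
    rw [h, EReal.coe_mul_top_of_pos hβ, EReal.top_add_coe, top_le_iff, ← hφ.coe_toReal hy] at this
    exact EReal.coe_ne_top _ (by exact_mod_cast this)
  refine ⟨hpd, (hφ.mem_subdiff_iff hpd).2 fun v hv => ?_⟩
  -- Compare `p` with `p + t • (v - p)`, divide by `t`, then let `t` tend to `0`.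
  have key : ∀ t ∈ Ioc (0 : ℝ) 1,
      ⟪x - p, v - p⟫ ≤ β * ((φ v).toReal - (φ p).toReal) + t * (‖v - p‖ ^ 2 / 2) := by
    intro t ht
    obtain ⟨hd, hle⟩ := hφ.segment_le hpd hv ⟨ht.1.le, ht.2⟩
    have h := hp (p + t • (v - p))
    simp only at h
    rw [← hφ.coe_toReal hd, ← hφ.coe_toReal hpd] at h
    have h' : β * (φ p).toReal + 1 / 2 * ‖x - p‖ ^ 2 ≤
        β * (φ (p + t • (v - p))).toReal + 1 / 2 * ‖x - (p + t • (v - p))‖ ^ 2 := by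
      exact_mod_cast h
    have hn : ‖x - (p + t • (v - p))‖ ^ 2 =
        ‖x - p‖ ^ 2 - 2 * (t * ⟪x - p, v - p⟫) + t ^ 2 * ‖v - p‖ ^ 2 := by
      rw [← sub_sub, norm_sub_sq_real, inner_smul_right, norm_smul, mul_pow, Real.norm_eq_abs,
        sq_abs]
    rw [hn] at h'
    have h2 := mul_le_mul_of_nonneg_left hle hβ.le
    refine le_of_mul_le_mul_left ?_ ht.1
    nlinarith
  have hlim : Tendsto (fun t : ℝ => β * ((φ v).toReal - (φ p).toReal) + t * (‖v - p‖ ^ 2 / 2))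
      (𝓝[>] 0) (𝓝 (β * ((φ v).toReal - (φ p).toReal))) := by
    have : Continuous fun t : ℝ =>
      β * ((φ v).toReal - (φ p).toReal) + t * (‖v - p‖ ^ 2 / 2) := by fun_prop
    simpa using (this.tendsto 0).mono_left nhdsWithin_le_nhds
  have h := ge_of_tendsto hlim (by
    filter_upwards [Ioc_mem_nhdsGT (zero_lt_one' ℝ)] with t ht using key t ht)
  rw [inner_smul_left]
  have : β⁻¹ * ⟪x - p, v - p⟫ ≤ (φ v).toReal - (φ p).toReal := by
    rwa [inv_mul_le_iff₀ hβ]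
  simp only [conj_trivial]
  linarith

/-- The Yosida approximation of a subdifferential is dominated in norm by every subgradient. -/
theorem IsGamma0.norm_prox_le {φ : H → EReal} (hφ : IsGamma0 φ) {β : ℝ} (hβ : 0 < β) {x p u : H}
    (hp : IsProx (fun v => (β : EReal) * φ v) x p) (hu : u ∈ subdiff φ x) :
    ‖β⁻¹ • (x - p)‖ ≤ ‖u‖ := by
  obtain ⟨hpd, hw⟩ := hφ.prox_spec hβ hp
  have hxd := hφ.mem_dom_of_mem_subdiff hu
  have h1 := (hφ.mem_subdiff_iff hpd).1 hw x hxd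
  have h2 := (hφ.mem_subdiff_iff hxd).1 hu p hpd
  set w := β⁻¹ • (x - p) with hwdef
  have hx : x - p = β • w := by rw [hwdef, smul_inv_smul₀ hβ.ne']
  rw [← neg_sub x p, inner_neg_right, hx, inner_smul_right] at h2
  rw [hx, inner_smul_right, real_inner_self_eq_norm_sq] at h1
  -- Monotonicity: adding the two subgradient inequalities gives `⟪u - w, x - p⟫ ≥ 0`, where `x - p
  -- = β • w`.
  have h3 : ‖w‖ ^ 2 ≤ ⟪u, w⟫ := le_of_mul_le_mul_left (by linarith) hβ
  have h4 := real_inner_le_norm u w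
  by_contra! h
  nlinarith [norm_nonneg u]

/-- Continuous functionals are bounded on a weakly compact set; Banach–Steinhaus makes the bound
uniform. -/
theorem isBounded_of_isCompact_weak {C : Set H} [CompleteSpace H]
    (hC : IsCompact (toWeakSpace ℝ H '' C)) : ∃ R, ∀ x ∈ C, ‖x‖ ≤ R := by
  have h : ∀ u : H, ∃ B, ∀ i : C, ‖innerSL ℝ (i : H) u‖ ≤ B := by
    intro u
    obtain ⟨B, hB⟩ := (hC.image (WeakBilin.eval_continuous _ (innerSL ℝ u))).isBounded.exists_norm_le
    refine ⟨B, fun i => ?_⟩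
    have := hB _ (mem_image_of_mem _ (mem_image_of_mem _ i.2))
    rw [innerSL_apply_apply, real_inner_comm]
    exact this
  obtain ⟨R, hR⟩ := banach_steinhaus h
  refine ⟨R, fun x hx => ?_⟩
  simpa using hR ⟨x, hx⟩

/-- The descent inequality for the smooth part. -/
theorem IsSmoothPair.descent [CompleteSpace H] {φ G : H → EReal} {C : Set H} {ζ : ℝ → ℝ}
    (hs : IsSmoothPair φ C G ζ) (hC : Convex ℝ C) :
    ∃ K : ℝ, ∀ x ∈ C, ∀ s ∈ C, ∀ γ ∈ Ioc (0 : ℝ) 1, (φ (x + γ • (s - x))).toReal ≤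
      (φ x).toReal + γ * ⟪grad φ x, s - x⟫ + K * ζ γ := by
  obtain ⟨hφb, hGb, hCd, -, C₀, hC₀, hCC, hCG, hCφ, hGd, hφd, hcv, K, hK⟩ := hs
  refine ⟨K, fun x hx s hsC γ hγ => ?_⟩
  have hz : x + γ • (s - x) ∈ C := hC.add_smul_sub_mem hx hsC ⟨hγ.1.le, hγ.2⟩
  have hb := hK x hx s hsC γ hγ
  set z := x + γ • (s - x) with hzdef
  have hGr : ∀ w ∈ C, ((G w).toReal : EReal) = G w := fun w hw =>
    EReal.coe_toReal (LT.lt.ne (show G w < ⊤ from interior_subset (s := dom G) (hCG (hCC hw)))) (hGb w)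
  have hb' : (G z).toReal - (G x).toReal - ⟪grad G x, z - x⟫ ≤ K * ζ γ := by
    rw [bregman, ← hGr z hz, ← hGr x hx] at hb
    exact_mod_cast hb
  have hseg : segment ℝ x z ⊆ C₀ := (hC.segment_subset hx hz).trans hCC
  have hdx := (hGd x (hCC hx)).sub (hφd x (hCC hx))
  -- Convexity of `G - φ` on the segment says that the Bregman divergence of `φ` is at most that of
  -- `G`.
  have h1 := inner_gradient_le (w := z) hdx (by
    intro t ht
    have := (hcv x z hseg).2 (left_mem_segment ℝ x z) (right_mem_segment ℝ x z)
      (sub_nonneg.2 ht.2) ht.1.le (by ring)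
    have e : (1 - t) • x + t • z = x + t • (z - x) := by module
    rw [e] at this
    simpa using this)
  have hgr : gradient ((fun y => (G y).toReal) - fun y => (φ y).toReal) x =
      grad G x - grad φ x := by
    have := (hGd x (hCC hx)).hasGradientAt.hasFDerivAt.sub (hφd x (hCC hx)).hasGradientAt.hasFDerivAt
    rw [← map_sub] at this
    exact HasGradientAt.gradient (hasGradientAt_iff_hasFDerivAt.2 this)
  rw [hgr, inner_sub_left] at h1
  simp only [Pi.sub_apply] at h1
  have e : z - x = γ • (s - x) := by rw [hzdef]; abel
  have e2 : ⟪grad φ x, z - x⟫ = γ * ⟪grad φ x, s - x⟫ := by rw [e, inner_smul_right]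
  linarith

end Convex

/-! ### Lyapunov argument for the augmented dual function. -/

section Dual

variable {E D : Type*} [NormedAddCommGroup D] [InnerProductSpace ℝ D]

theorem exists_forall_le_of_le_add_summable {d ε : ℕ → ℝ} (hε : Summable ε)
    (hd : ∀ k, d (k + 1) ≤ d k + ε k) : ∃ B, ∀ k, d k ≤ B := by
  have h : ∀ k, d k ≤ d 0 + ∑ i ∈ Finset.range k, ε i := by
    intro k
    induction k with
    | zero => simp
    | succ k ih => rw [Finset.sum_range_succ]; linarith [hd k]
  obtain ⟨B, hB⟩ := hε.hasSum.tendsto_sum_nat.bddAbove_range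
  exact ⟨d 0 + B, fun k => (h k).trans (by linarith [hB (mem_range_self k)])⟩

theorem summable_sub_succ_of_tendsto {u : ℕ → ℝ} {l : ℝ} (hu : Tendsto u atTop (𝓝 l))
    (hm : Monotone u) : Summable fun k => u (k + 1) - u k := by
  refine summable_of_sum_range_le (c := l - u 0) (fun k => sub_nonneg.2 (hm k.le_succ)) fun n => ?_
  rw [Finset.sum_range_sub]
  linarith [hm.ge_of_tendsto hu n]

/-- A primal-dual Lyapunov argument: if the primal values `p k` satisfy a conditional gradient
descent inequality for the augmented Lagrangian and the multipliers follow dual gradient ascent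
with short steps, then the augmented dual function is bounded below along the multipliers. -/
theorem exists_lower_bound_augmented_lagrangian {C : Set E} {Ψ : E → ℝ} {q : E → D} {R m : ℝ}
    (hR : ∀ w ∈ C, ‖q w‖ ≤ R) (hm : ∀ w ∈ C, m ≤ Ψ w)
    {x : ℕ → E} {μ : ℕ → D} {p γ θ ρ η ε : ℕ → ℝ} {N : ℝ}
    (hx : ∀ k, x k ∈ C) (hγ : ∀ k, γ k ∈ Ioc (0 : ℝ) 1)
    (hρ : ∀ k, 0 ≤ ρ k) (hρm : Monotone ρ) (hρb : BddAbove (range ρ))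
    (hθ : ∀ k, 0 ≤ θ k) (hθρ : ∀ k, θ k ≤ ρ (k + 1) / 2 * γ (k + 1))
    (hε : Summable ε) (hγη : Summable fun k => γ k * η k) (hη : ∀ k, η k ≤ N)
    (hμ : ∀ k, μ (k + 1) = μ k + θ k • q (x (k + 1)))
    (hlow : ∀ k, Ψ (x k) ≤ p k + η k)
    (hstep : ∀ k, ∀ w ∈ C,
      p (k + 1) + ⟪μ k, q (x (k + 1))⟫ + ρ k / 2 * ‖q (x (k + 1))‖ ^ 2 ≤
        (p k + ⟪μ k, q (x k)⟫ + ρ k / 2 * ‖q (x k)‖ ^ 2) +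
        γ k * ((Ψ w + ⟪μ k, q w⟫ + ρ k / 2 * ‖q w‖ ^ 2) -
          (p k + ⟪μ k, q (x k)⟫ + ρ k / 2 * ‖q (x k)‖ ^ 2) -
          ρ k / 2 * ‖q w - q (x k)‖ ^ 2) + ε k) :
    ∃ B, ∀ k, ∀ w ∈ C, -B ≤ Ψ w + ⟪μ k, q w⟫ + ρ k / 2 * ‖q w‖ ^ 2 := by
  set Λ : ℕ → E → ℝ := fun k w => Ψ w + ⟪μ k, q w⟫ + ρ k / 2 * ‖q w‖ ^ 2 with hΛ
  set Q : ℕ → ℝ := fun k => ⨅ w : C, Λ k w with hQ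
  -- The indices are mixed on purpose: the primal point and penalty are already updated, the
  -- multiplier is not.
  set b : ℕ → ℝ := fun k =>
    p (k + 1) + ⟪μ k, q (x (k + 1))⟫ + ρ (k + 1) / 2 * ‖q (x (k + 1))‖ ^ 2 with hb
  have : Nonempty C := ⟨⟨x 0, hx 0⟩⟩
  have hbdd : ∀ k, BddBelow (range fun w : C => Λ k w) := by
    refine fun k => ⟨m - ‖μ k‖ * R, ?_⟩
    rintro _ ⟨w, rfl⟩
    have h1 := hm w w.2
    have h2 := neg_le_of_abs_le (abs_real_inner_le_norm (μ k) (q w))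
    have h3 := mul_le_mul_of_nonneg_left (hR w w.2) (norm_nonneg (μ k))
    have h4 : 0 ≤ ρ k / 2 * ‖q w‖ ^ 2 := mul_nonneg (by linarith [hρ k]) (by positivity)
    simp only [hΛ]
    linarith
  have hQle : ∀ k, ∀ w ∈ C, Q k ≤ Λ k w := fun k w hw => ciInf_le (hbdd k) ⟨w, hw⟩
  have hsq : ∀ w ∈ C, ‖q w‖ ^ 2 ≤ R ^ 2 := fun w hw =>
    pow_le_pow_left₀ (norm_nonneg _) (hR w hw) 2
  -- The dual update contributes `2 * θ k * ⟪q (x (k + 1)), q w⟫` to the bound on `b` and half of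
  -- that to the bound on `Q`; the weight `2` cancels the cross terms.
  have hrec : ∀ k, b (k + 1) - 2 * Q (k + 1) ≤ (b k - 2 * Q k) +
      (γ (k + 1) * η (k + 1) + ε (k + 1) + (ρ (k + 2) - ρ (k + 1)) * (R ^ 2 / 2)) := by
    intro k
    -- The infimum need not be attained. A near-minimizer with slack `δ / 3` is used once in the
    -- primal gap and twice through `2 * Q`.
    refine le_of_forall_pos_le_add fun δ hδ => ?_
    obtain ⟨⟨w, hw⟩, hwQ⟩ := exists_lt_of_ciInf_lt
      (show ⨅ w : C, Λ (k + 1) w < Q (k + 1) + δ / 3 by simp only [hQ]; linarith)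
    simp only at hwQ
    have h1 := hstep (k + 1) w hw
    have h2 := hQle (k + 1) _ (hx (k + 1))
    have h3 := hQle k w hw
    have h4 := hlow (k + 1)
    have h5 := mul_le_mul_of_nonneg_left (hsq _ (hx (k + 2))) (sub_nonneg.2 (hρm (k + 1).le_succ))
    have h6 : 0 ≤ (ρ (k + 1) - ρ k) * ‖q w‖ ^ 2 :=
      mul_nonneg (sub_nonneg.2 (hρm k.le_succ)) (sq_nonneg _)
    -- The quadratic part of the gap dominates the dual step: this is where short dual steps enter.
    have h7 := mul_le_mul_of_nonneg_right (hθρ k) (sq_nonneg ‖q w - q (x (k + 1))‖)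
    have h8 : 0 ≤ θ k * ‖q w‖ ^ 2 := mul_nonneg (hθ k) (sq_nonneg _)
    have h9 : θ k * ‖q w - q (x (k + 1))‖ ^ 2 = θ k * ‖q w‖ ^ 2 -
        2 * (θ k * ⟪q (x (k + 1)), q w⟫) + θ k * ‖q (x (k + 1))‖ ^ 2 := by
      rw [norm_sub_sq_real, real_inner_comm]; ring
    have h10 : ⟪μ (k + 1), q (x (k + 1))⟫ =
        ⟪μ k, q (x (k + 1))⟫ + θ k * ‖q (x (k + 1))‖ ^ 2 := by
      rw [hμ, inner_add_left, inner_smul_left, real_inner_self_eq_norm_sq]; simp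
    have h11 : ⟪μ (k + 1), q w⟫ = ⟪μ k, q w⟫ + θ k * ⟪q (x (k + 1)), q w⟫ := by
      rw [hμ, inner_add_left, inner_smul_left]; simp
    have h12 : γ (k + 1) * (Λ (k + 1) w -
        (p (k + 1) + ⟪μ (k + 1), q (x (k + 1))⟫ + ρ (k + 1) / 2 * ‖q (x (k + 1))‖ ^ 2)) ≤
        γ (k + 1) * η (k + 1) + δ / 3 := by
      have : Λ (k + 1) w -
        (p (k + 1) + ⟪μ (k + 1), q (x (k + 1))⟫ + ρ (k + 1) / 2 * ‖q (x (k + 1))‖ ^ 2) ≤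
          η (k + 1) + δ / 3 := by
        simp only [hΛ] at hwQ h2 ⊢
        linarith
      have h := mul_le_mul_of_nonneg_left this (hγ (k + 1)).1.le
      have h' := mul_le_mul_of_nonneg_right (hγ (k + 1)).2 (show 0 ≤ δ / 3 by linarith)
      linarith
    simp only [hΛ, hb, show k + 1 + 1 = k + 2 from rfl, Nat.succ_eq_add_one] at *
    linarith
  have hsum : Summable fun k =>
      γ (k + 1) * η (k + 1) + ε (k + 1) + (ρ (k + 2) - ρ (k + 1)) * (R ^ 2 / 2) := by
    have h1 : Summable fun k => ρ (k + 1) - ρ k :=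
      summable_sub_succ_of_tendsto (tendsto_atTop_ciSup hρm hρb) hρm
    exact (((summable_nat_add_iff 1).2 hγη).add ((summable_nat_add_iff 1).2 hε)).add
      (((summable_nat_add_iff 1).2 h1).mul_right _)
  obtain ⟨B, hB⟩ := exists_forall_le_of_le_add_summable
    (d := fun k => b k - 2 * Q k) hsum hrec
  refine ⟨B + N, fun k w hw => ?_⟩
  have h1 := hB k
  have h2 := hQle k _ (hx (k + 1))
  have h3 := hQle k w hw
  have h4 := hlow (k + 1)
  have h5 := hη (k + 1)
  have h6 : 0 ≤ (ρ (k + 1) - ρ k) * ‖q (x (k + 1))‖ ^ 2 :=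
    mul_nonneg (sub_nonneg.2 (hρm k.le_succ)) (sq_nonneg _)
  simp only [hΛ, hb] at *
  linarith

end Dual

/-! ### Weak boundedness on the range of `A` and feasible directions. -/

section Range

variable {Hp Hd : Type*} [NormedAddCommGroup Hp] [InnerProductSpace ℝ Hp]
  [NormedAddCommGroup Hd] [InnerProductSpace ℝ Hd] [CompleteSpace Hd]

/-- Vectors of a complete subspace that are weakly bounded on it are bounded. -/
theorem isBounded_range_of_inner_le {S : Submodule ℝ Hd} (hS : IsClosed (S : Set Hd))
    {μ : ℕ → Hd} (hμ : ∀ k, μ k ∈ S) (hb : ∀ w ∈ S, ∃ B, ∀ k, -B ≤ ⟪μ k, w⟫) :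
    Bornology.IsBounded (range μ) := by
  have : CompleteSpace S := hS.completeSpace_coe
  have h : ∀ w : S, ∃ B, ∀ k, ‖innerSL ℝ (⟨μ k, hμ k⟩ : S) w‖ ≤ B := by
    intro w
    obtain ⟨B, hB⟩ := hb w w.2
    obtain ⟨B', hB'⟩ := hb (-w) (S.neg_mem w.2)
    refine ⟨max B B', fun k => ?_⟩
    have h1 := hB k
    have h2 := hB' k
    rw [inner_neg_right] at h2
    rw [innerSL_apply_apply, Real.norm_eq_abs]
    change |⟪μ k, (w : Hd)⟫| ≤ _
    exact abs_le.2 ⟨by linarith [le_max_left B B'], by linarith [le_max_right B B']⟩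
  obtain ⟨R, hR⟩ := banach_steinhaus h
  refine isBounded_iff_forall_norm_le.2 ⟨R, ?_⟩
  rintro _ ⟨k, rfl⟩
  simpa using hR k

/-- Under a qualification condition, some feasible point can be moved inside `C` along preimages of
all directions of the range of `A`. -/
theorem exists_feasible_direction [CompleteSpace Hp] {Hv : Type*} [NormedAddCommGroup Hv]
    [InnerProductSpace ℝ Hv] {g : Hv → EReal} {h : Hp → EReal} {T : Hp →L[ℝ] Hv}
    {A : Hp →L[ℝ] Hd} {b : Hd} (hsub : dom h ⊆ dom fun x => g (T x))
    (hq : InteriorCondition g h T A b ∨ RelativeInteriorCondition g h T A b) :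
    b ∈ A.range ∧ ∀ w ∈ A.range, ∃ v ∈ dom h, ∃ t : ℝ, 0 < t ∧ A v - b = t • w := by
  rcases hq with ⟨x, ⟨hxb, -⟩, hxi⟩ | ⟨hfp, hfd, ⟨x, ⟨hxb, -⟩, hxi⟩, hV⟩
  · have hxb : A x = b := hxb
    refine ⟨⟨x, hxb⟩, ?_⟩
    rintro _ ⟨u, rfl⟩
    have hc : Tendsto (fun t : ℝ => x + t • u) (𝓝[>] 0) (𝓝 x) := by
      have : Continuous fun t : ℝ => x + t • u := by fun_prop
      simpa using (this.tendsto 0).mono_left nhdsWithin_le_nhds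
    obtain ⟨t, ht, ht0⟩ := ((hc.eventually_mem (mem_interior_iff_mem_nhds.1 hxi)).and
      self_mem_nhdsWithin).exists
    exact ⟨x + t • u, ht, t, ht0, by simp [hxb]⟩
  · have hxb : A x = b := hxb
    refine ⟨⟨x, hxb⟩, ?_⟩
    rw [inter_eq_self_of_subset_right hsub] at hV
    set V := vectorSpan ℝ (dom h) with hVdef
    -- If `ν` is orthogonal to `A V`, then `A* ν` lies in `ran A* ∩ Vᗮ = {0}`, so `ν` is orthogonal
    -- to the range of `A`.
    have hle : A.range ≤ V.map (A : Hp →ₗ[ℝ] Hd) := by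
      rw [← Submodule.orthogonal_orthogonal (V.map (A : Hp →ₗ[ℝ] Hd))]
      intro w hw
      obtain ⟨u, rfl⟩ := hw
      rw [Submodule.mem_orthogonal]
      intro ν hν
      have h1 : ContinuousLinearMap.adjoint A ν ∈
          (range (ContinuousLinearMap.adjoint A) : Set Hp) ∩ ((Vᗮ : Submodule ℝ Hp) : Set Hp) := by
        refine ⟨mem_range_self _, (Submodule.mem_orthogonal _ _).2 fun u hu => ?_⟩
        rw [ContinuousLinearMap.adjoint_inner_right]
        exact (Submodule.mem_orthogonal _ _).1 hν _ (Submodule.mem_map_of_mem hu)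
      rw [hV] at h1
      have h2 : ContinuousLinearMap.adjoint A ν = 0 := h1
      change ⟪ν, A u⟫ = 0
      rw [← ContinuousLinearMap.adjoint_inner_left, h2, inner_zero_left]
    intro w hw
    obtain ⟨u, hu, rfl⟩ := hle hw
    obtain ⟨y, hy, hyx⟩ := mem_intrinsicInterior.1 hxi
    -- Moving along `V` stays in the affine span, where the relative interior is an ordinary
    -- interior.
    have hmem : ∀ t : ℝ, x + t • u ∈ affineSpan ℝ (dom h) := by
      intro t
      have : t • u +ᵥ (y : Hp) ∈ affineSpan ℝ (dom h) :=
        AffineSubspace.vadd_mem_of_mem_direction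
          (by rw [direction_affineSpan]; exact V.smul_mem t hu) y.2
      rw [hyx] at this
      rwa [add_comm]
    have hc : Tendsto (fun t : ℝ => (⟨x + t • u, hmem t⟩ : affineSpan ℝ (dom h)))
        (𝓝[>] 0) (𝓝 y) := by
      have hcont : Continuous fun t : ℝ => (⟨x + t • u, hmem t⟩ : affineSpan ℝ (dom h)) := by
        fun_prop
      have h0 : (⟨x + (0 : ℝ) • u, hmem 0⟩ : affineSpan ℝ (dom h)) = y :=
        Subtype.ext (by simp [hyx])
      have := (hcont.tendsto 0).mono_left (nhdsWithin_le_nhds (s := Ioi 0))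
      rwa [h0] at this
    obtain ⟨t, ht, ht0⟩ := ((hc.eventually_mem (mem_interior_iff_mem_nhds.1 hy)).and
      self_mem_nhdsWithin).exists
    exact ⟨x + t • u, ht, t, ht0, by simp [hxb]⟩

end Range

/-! ### Moreau envelope estimates. -/

section Moreau

variable {H : Type*} [NormedAddCommGroup H] [InnerProductSpace ℝ H]

/-- The value of the Moreau envelope of `φ` with parameter `β` at `x`, where `p` is the proximal
point of `x`. -/
noncomputable def moreau (φ : H → EReal) (β : ℝ) (x p : H) : ℝ :=
  (φ p).toReal + β / 2 * ‖β⁻¹ • (x - p)‖ ^ 2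

/-- Moving the base point of the subgradient inequality from `p` to `x` gains `β * ‖w‖ ^ 2`, with `w
= β⁻¹ • (x - p)`, twice what the envelope adds to `φ p`. -/
theorem IsGamma0.moreau_add_inner_le {φ : H → EReal} (hφ : IsGamma0 φ) {β : ℝ} (hβ : 0 < β)
    {x p v : H} (hp : IsProx (fun v => (β : EReal) * φ v) x p) (hv : v ∈ dom φ) :
    moreau φ β x p + ⟪β⁻¹ • (x - p), v - x⟫ ≤ (φ v).toReal := by
  obtain ⟨hpd, hw⟩ := hφ.prox_spec hβ hp
  have h1 := (hφ.mem_subdiff_iff hpd).1 hw v hv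
  rw [moreau]
  set w := β⁻¹ • (x - p) with hwdef
  have hx : x - p = β • w := by rw [hwdef, smul_inv_smul₀ hβ.ne']
  have h2 : ⟪w, v - p⟫ = ⟪w, v - x⟫ + β * ‖w‖ ^ 2 := by
    rw [show v - p = (v - x) + (x - p) by abel, hx, inner_add_right, inner_smul_right,
      real_inner_self_eq_norm_sq]
  have h3 : 0 ≤ β * ‖w‖ ^ 2 := by positivity
  linarith

/-- Smoothing costs `O(β)`: apply the subgradient inequality at `x` to `p`, then Young's inequality.
-/
theorem IsGamma0.le_moreau_add {φ : H → EReal} (hφ : IsGamma0 φ) {β : ℝ} (hβ : 0 < β)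
    {x p u : H} (hp : IsProx (fun v => (β : EReal) * φ v) x p) (hu : u ∈ subdiff φ x) :
    (φ x).toReal ≤ moreau φ β x p + β * (‖u‖ ^ 2 / 2) := by
  obtain ⟨hpd, -⟩ := hφ.prox_spec hβ hp
  have h1 := (hφ.mem_subdiff_iff (hφ.mem_dom_of_mem_subdiff hu)).1 hu p hpd
  rw [moreau]
  set w := β⁻¹ • (x - p) with hwdef
  have hx : x - p = β • w := by rw [hwdef, smul_inv_smul₀ hβ.ne']
  have h2 : ⟪u, p - x⟫ = -(β * ⟪u, w⟫) := by
    rw [← neg_sub, hx, inner_neg_right, inner_smul_right]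
  have h3 : 0 ≤ β * ‖u - w‖ ^ 2 := by positivity
  rw [norm_sub_sq_real] at h3
  linarith

/-- Change of the Moreau envelope when both the point and the parameter change. -/
theorem IsGamma0.moreau_le_moreau_add {φ : H → EReal} (hφ : IsGamma0 φ) {β β' : ℝ} (hβ : 0 < β)
    (hβ' : 0 < β') {x p x' p' : H} (hp : IsProx (fun v => (β : EReal) * φ v) x p)
    (hp' : IsProx (fun v => (β' : EReal) * φ v) x' p') :
    moreau φ β' x' p' ≤ moreau φ β x p + ⟪β⁻¹ • (x - p), x' - x⟫ + ‖x' - x‖ ^ 2 / (2 * β) +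
      (β - β') * (‖β'⁻¹ • (x' - p')‖ ^ 2 / 2) := by
  obtain ⟨hpd, -⟩ := hφ.prox_spec hβ hp
  obtain ⟨hpd', hw'⟩ := hφ.prox_spec hβ' hp'
  have h1 := (hφ.mem_subdiff_iff hpd').1 hw' p hpd
  rw [moreau, moreau]
  set w := β⁻¹ • (x - p) with hwdef
  set w' := β'⁻¹ • (x' - p') with hwdef'
  have hx : x - p = β • w := by rw [hwdef, smul_inv_smul₀ hβ.ne']
  have hx' : x' - p' = β' • w' := by rw [hwdef', smul_inv_smul₀ hβ'.ne']
  clear_value w w'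
  have h2 : ⟪w', p - p'⟫ = β' * ‖w'‖ ^ 2 - β * ⟪w', w⟫ - ⟪w', x' - x⟫ := by
    rw [show p - p' = (x' - p') - (x - p) - (x' - x) by abel, hx, hx', inner_sub_right,
      inner_sub_right, inner_smul_right, inner_smul_right, real_inner_self_eq_norm_sq]
  -- After testing the subgradient `w'` at `p`, the slack in the claim is exactly this square.
  have h3 : 0 ≤ ‖β • (w' - w) - (x' - x)‖ ^ 2 / (2 * β) := by positivity
  have h4 : ‖β • (w' - w) - (x' - x)‖ ^ 2 / (2 * β) =
      β / 2 * (‖w'‖ ^ 2 - 2 * ⟪w', w⟫ + ‖w‖ ^ 2) - (⟪w', x' - x⟫ - ⟪w, x' - x⟫) +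
        ‖x' - x‖ ^ 2 / (2 * β) := by
    rw [norm_sub_sq_real, norm_smul, mul_pow, Real.norm_eq_abs, sq_abs, norm_sub_sq_real,
      real_inner_smul_left, inner_sub_left]
    field_simp
  linarith

end Moreau

/-! ### Descent along the iterates. -/

section Run

variable {Hp Hd Hv : Type*}
  [NormedAddCommGroup Hp] [InnerProductSpace ℝ Hp] [CompleteSpace Hp]
  [NormedAddCommGroup Hd] [InnerProductSpace ℝ Hd] [CompleteSpace Hd]
  [NormedAddCommGroup Hv] [InnerProductSpace ℝ Hv] [CompleteSpace Hv]
  {f h : Hp → EReal} {g : Hv → EReal} {T : Hp →L[ℝ] Hv} {A : Hp →L[ℝ] Hd} {b : Hd}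
  {γ β θ ρ : ℕ → ℝ} {x : ℕ → Hp} {μ : ℕ → Hd} {y : ℕ → Hv} {z s : ℕ → Hp}

namespace IsRun

theorem s_mem (hrun : IsRun f g h T A b γ β θ ρ x μ y z s) (hh : IsGamma0 h) (k : ℕ) :
    s k ∈ dom h := by
  refine (lt_top_iff_ne_top (α := EReal)).2 fun hs => ?_
  have := hrun.s_step k (x 0)
  rw [hs, EReal.top_add_coe, top_le_iff, ← hh.coe_toReal hrun.x_zero] at this
  exact EReal.coe_ne_top _ (by exact_mod_cast this)

theorem x_succ (hrun : IsRun f g h T A b γ β θ ρ x μ y z s) (k : ℕ) :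
    x (k + 1) = x k + γ k • (s k - x k) := by
  rw [hrun.x_step, ← neg_sub (x k), smul_neg, sub_eq_add_neg]

theorem x_mem (hrun : IsRun f g h T A b γ β θ ρ x μ y z s) (hh : IsGamma0 h)
    (hγ : ∀ k, γ k ∈ Ioc (0 : ℝ) 1) (k : ℕ) : x k ∈ dom h := by
  induction k with
  | zero => exact hrun.x_zero
  | succ k ih =>
    rw [hrun.x_succ]
    exact hh.convex_dom.add_smul_sub_mem ih (hrun.s_mem hh k) ⟨(hγ k).1.le, (hγ k).2⟩

theorem μ_mem (hrun : IsRun f g h T A b γ β θ ρ x μ y z s) (hb : b ∈ A.range) (k : ℕ) :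
    μ k ∈ A.range := by
  induction k with
  | zero => exact hrun.μ_zero
  | succ k ih =>
    rw [hrun.μ_step]
    exact add_mem ih (Submodule.smul_mem _ _ (sub_mem ⟨_, rfl⟩ hb))

theorem inner_z (hrun : IsRun f g h T A b γ β θ ρ x μ y z s) (k : ℕ) (v : Hp) :
    ⟪z k, v⟫ = ⟪grad f (x k), v⟫ + ⟪(β k)⁻¹ • (T (x k) - y k), T v⟫ + ⟪μ k, A v⟫ +
      ρ k * ⟪A (x k) - b, A v⟫ := by
  rw [hrun.z_step]
  simp only [inner_add_left, inner_smul_left, ContinuousLinearMap.adjoint_inner_left, conj_trivial]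

theorem s_step_real (hrun : IsRun f g h T A b γ β θ ρ x μ y z s) (hh : IsGamma0 h) (k : ℕ) {w : Hp}
    (hw : w ∈ dom h) :
    (h (s k)).toReal + ⟪z k, s k - x k⟫ ≤ (h w).toReal + ⟪z k, w - x k⟫ := by
  have := hrun.s_step k w
  rw [← hh.coe_toReal hw, ← hh.coe_toReal (hrun.s_mem hh k)] at this
  have h' : (h (s k)).toReal + ⟪z k, s k⟫ ≤ (h w).toReal + ⟪z k, w⟫ := by exact_mod_cast this
  rw [inner_sub_right, inner_sub_right]
  linarith

/-- One step of the algorithm decreases the smoothed augmented Lagrangian up to error terms. -/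
theorem augmented_lagrangian_step (hrun : IsRun f g h T A b γ β θ ρ x μ y z s)
    (hg : IsGamma0 g) (hf : IsGamma0 f) (hh : IsGamma0 h)
    (hfd : ∀ w ∈ dom h, DifferentiableAt ℝ (fun y => (f y).toReal) w)
    (hhf : dom h ⊆ dom f) (hhg : dom h ⊆ dom fun x => g (T x))
    (hγ : ∀ k, γ k ∈ Ioc (0 : ℝ) 1) (hβ : ∀ k, 0 < β k) (hρ : ∀ k, 0 ≤ ρ k)
    {δ M d r : ℝ} {k : ℕ} (hβk : β (k + 1) ≤ β k) (hr : ρ k ≤ r)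
    (hdesc : (f (x k + γ k • (s k - x k))).toReal ≤
      (f (x k)).toReal + γ k * ⟪grad f (x k), s k - x k⟫ + δ)
    (hM : ‖(β (k + 1))⁻¹ • (T (x (k + 1)) - y (k + 1))‖ ≤ M) (hd : ‖s k - x k‖ ≤ d)
    {w : Hp} (hw : w ∈ dom h) :
    ((f (x (k + 1))).toReal + moreau g (β (k + 1)) (T (x (k + 1))) (y (k + 1)) +
        (h (x (k + 1))).toReal) +
      ⟪μ k, A (x (k + 1)) - b⟫ + ρ k / 2 * ‖A (x (k + 1)) - b‖ ^ 2 ≤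
    (((f (x k)).toReal + moreau g (β k) (T (x k)) (y k) + (h (x k)).toReal) +
      ⟪μ k, A (x k) - b⟫ + ρ k / 2 * ‖A (x k) - b‖ ^ 2) +
    γ k * ((((f w).toReal + (g (T w)).toReal + (h w).toReal) + ⟪μ k, A w - b⟫ +
        ρ k / 2 * ‖A w - b‖ ^ 2) -
      (((f (x k)).toReal + moreau g (β k) (T (x k)) (y k) + (h (x k)).toReal) +
      ⟪μ k, A (x k) - b⟫ + ρ k / 2 * ‖A (x k) - b‖ ^ 2) -
      ρ k / 2 * ‖(A w - b) - (A (x k) - b)‖ ^ 2) +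
    (δ + γ k ^ 2 / β k * ((‖T‖ * d) ^ 2 / 2) + γ k ^ 2 * (r * (‖A‖ * d) ^ 2 / 2) +
      (β k - β (k + 1)) * (M ^ 2 / 2)) := by
  have hxk := hrun.x_mem hh hγ k
  have hxs := hrun.x_succ k
  rw [← hxs] at hdesc
  have hhle := (hh.segment_le hxk (hrun.s_mem hh k) ⟨(hγ k).1.le, (hγ k).2⟩).2
  rw [← hxs] at hhle
  have hmor := hg.moreau_le_moreau_add (hβ k) (hβ (k + 1)) (hrun.y_step k) (hrun.y_step (k + 1))
  have hT : T (x (k + 1)) - T (x k) = γ k • T (s k - x k) := by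
    rw [← map_sub, hxs, add_sub_cancel_left, map_smul]
  have hA : A (x (k + 1)) - b = (A (x k) - b) + γ k • A (s k - x k) := by
    rw [hxs, map_add, map_smul]; abel
  have hTn : ‖T (s k - x k)‖ ^ 2 ≤ (‖T‖ * d) ^ 2 :=
    pow_le_pow_left₀ (norm_nonneg _) ((T.le_opNorm _).trans (by gcongr)) 2
  have hAn : ‖A (s k - x k)‖ ^ 2 ≤ (‖A‖ * d) ^ 2 :=
    pow_le_pow_left₀ (norm_nonneg _) ((A.le_opNorm _).trans (by gcongr)) 2
  rw [hT, inner_smul_right, norm_smul, mul_pow, Real.norm_eq_abs, sq_abs] at hmor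
  have e1 : γ k ^ 2 * ‖T (s k - x k)‖ ^ 2 / (2 * β k) ≤
      γ k ^ 2 / β k * ((‖T‖ * d) ^ 2 / 2) := by
    have := mul_le_mul_of_nonneg_left hTn (div_nonneg (sq_nonneg (γ k)) (hβ k).le)
    calc γ k ^ 2 * ‖T (s k - x k)‖ ^ 2 / (2 * β k) =
        γ k ^ 2 / β k * ‖T (s k - x k)‖ ^ 2 / 2 := by field_simp
      _ ≤ _ := by linarith
  have e2 : (β k - β (k + 1)) * (‖(β (k + 1))⁻¹ • (T (x (k + 1)) - y (k + 1))‖ ^ 2 / 2) ≤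
      (β k - β (k + 1)) * (M ^ 2 / 2) := by
    have : 0 ≤ β k - β (k + 1) := sub_nonneg.2 hβk
    gcongr
  have e3 : ⟪μ k, A (x (k + 1)) - b⟫ =
      ⟪μ k, A (x k) - b⟫ + γ k * ⟪μ k, A (s k - x k)⟫ := by
    rw [hA, inner_add_right, inner_smul_right]
  have e4 : ρ k / 2 * ‖A (x (k + 1)) - b‖ ^ 2 ≤ ρ k / 2 * ‖A (x k) - b‖ ^ 2 +
      γ k * (ρ k * ⟪A (x k) - b, A (s k - x k)⟫) + γ k ^ 2 * (r * (‖A‖ * d) ^ 2 / 2) := by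
    have h1 : ρ k * ‖A (s k - x k)‖ ^ 2 ≤ r * (‖A‖ * d) ^ 2 :=
      mul_le_mul hr hAn (sq_nonneg _) ((hρ k).trans hr)
    have h2 := mul_le_mul_of_nonneg_left h1 (sq_nonneg (γ k))
    rw [hA, norm_add_sq_real, inner_smul_right, norm_smul, mul_pow, Real.norm_eq_abs, sq_abs]
    linarith
  -- Optimality of `s k` allows any competitor `w`; convexity bounds the `f` and envelope terms,
  -- while the quadratic penalty expands exactly and leaves the negative square.
  have hbr : (h (s k)).toReal - (h (x k)).toReal + ⟪z k, s k - x k⟫ ≤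
      (((f w).toReal + (g (T w)).toReal + (h w).toReal) + ⟪μ k, A w - b⟫ +
        ρ k / 2 * ‖A w - b‖ ^ 2) -
      (((f (x k)).toReal + moreau g (β k) (T (x k)) (y k) + (h (x k)).toReal) +
      ⟪μ k, A (x k) - b⟫ + ρ k / 2 * ‖A (x k) - b‖ ^ 2) -
      ρ k / 2 * ‖(A w - b) - (A (x k) - b)‖ ^ 2 := by
    have h1 := hrun.s_step_real hh k hw
    have h2 := hf.inner_grad_le (hhf hxk) (hhf hw) (hfd _ hxk)
    have h3 := hg.moreau_add_inner_le (hβ k) (hrun.y_step k) (v := T w) (hhg hw)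
    have hAw : A (w - x k) = (A w - b) - (A (x k) - b) := by rw [map_sub]; abel
    have h4 := hrun.inner_z k (w - x k)
    rw [← map_sub] at h3
    rw [hAw, inner_sub_right (μ k), inner_sub_right (A (x k) - b),
      real_inner_self_eq_norm_sq] at h4
    have h5 : ρ k * ‖(A w - b) - (A (x k) - b)‖ ^ 2 = ρ k * ‖A w - b‖ ^ 2 -
        2 * (ρ k * ⟪A (x k) - b, A w - b⟫) + ρ k * ‖A (x k) - b‖ ^ 2 := by
      rw [norm_sub_sq_real, real_inner_comm]; ring
    linarith
  have hbr' := mul_le_mul_of_nonneg_left hbr (hγ k).1.le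
  rw [hrun.inner_z k (s k - x k)] at hbr'
  refine le_trans ?_ (add_le_add_left (add_le_add_right hbr' _) _)
  linarith

end IsRun

end Run

end CGALP

/-! ### Assembly of the dual bound. -/

theorem lemma4p9
    {Hp Hd Hv : Type*}
    [NormedAddCommGroup Hp] [InnerProductSpace ℝ Hp] [CompleteSpace Hp]
    [NormedAddCommGroup Hd] [InnerProductSpace ℝ Hd] [CompleteSpace Hd]
    [NormedAddCommGroup Hv] [InnerProductSpace ℝ Hv] [CompleteSpace Hv]
    (f h F : Hp → EReal) (g : Hv → EReal)
    (T : Hp →L[ℝ] Hv) (A : Hp →L[ℝ] Hd) (b : Hd) (ζ : ℝ → ℝ)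
    -- standing assumption on `g`, and `f`, `g ∘ T`, `h` in `Γ₀`
    (hg : CGALP.IsGamma0 g)
    (hf : CGALP.IsGamma0 f) (hgT : CGALP.IsGamma0 (fun x => g (T x))) (hh : CGALP.IsGamma0 h)
    -- `(f, dom h)` is `(F, ζ)`-smooth
    (hsmooth : CGALP.IsSmoothPair f (CGALP.dom h) F ζ)
    -- `dom h` is weakly compact
    (hcompact : IsCompact (toWeakSpace ℝ Hp '' CGALP.dom h))
    -- the minimal norm selection of `∂g` exists and is bounded on `T (dom h)`
    (hsub : T '' CGALP.dom h ⊆ CGALP.domSubdiff g)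
    (hsubbdd : ∃ M : ℝ, ∀ x ∈ CGALP.dom h, ∀ u,
      CGALP.IsMinNormSelection g (T x) u → ‖u‖ ≤ M)
    -- a saddle point exists
    (hsaddle : ∃ xs μs, CGALP.IsSaddlePoint f g h T A b xs μs)
    -- `A` has closed range
    (hrange : IsClosed (Set.range A))
    -- one of the two qualification conditions
    (hqual : CGALP.InteriorCondition g h T A b ∨ CGALP.RelativeInteriorCondition g h T A b)
    -- the parameters
    (γ β θ ρ : ℕ → ℝ) (γlo γhi c : ℝ)
    (hγ : ∀ k, γ k ∈ Set.Ioc (0 : ℝ) 1)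
    (hζγ : Summable fun k => ζ (γ k))
    (hγsq : Summable fun k => γ k ^ 2 / β k)
    (hγβ : Summable fun k => γ k * β k)
    (hγdiv : ¬ Summable γ)
    (hβpos : ∀ k, 0 < β k) (hβanti : Antitone β)
    (hβlim : Filter.Tendsto β Filter.atTop (nhds 0))
    (hρnonneg : ∀ k, 0 ≤ ρ k) (hρmono : Monotone ρ)
    (hρinf : 0 < ⨅ k, ρ k) (hρbdd : BddAbove (Set.range ρ))
    (hγlo : 0 < γlo) (hγhi : 0 < γhi)
    (hγratio_lo : ∀ k, γlo ≤ γ k / γ (k + 1)) (hγratio_hi : ∀ k, γ k / γ (k + 1) ≤ γhi)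
    (hc : 0 < c) (hθ : ∀ k, θ k = γ k / c) (hcρ : γhi / c - (⨅ k, ρ k) / 2 < 0)
    -- the iterates
    (x : ℕ → Hp) (μ : ℕ → Hd) (y : ℕ → Hv) (z s : ℕ → Hp)
    (hrun : CGALP.IsRun f g h T A b γ β θ ρ x μ y z s) :
    Bornology.IsBounded (Set.range μ) := by
  obtain ⟨ρlo, hρlo⟩ : ∃ ρlo, ρlo = ⨅ k, ρ k := ⟨_, rfl⟩
  rw [← hρlo] at hcρ
  have hρge : ∀ k, ρlo ≤ ρ k := fun k => by
    rw [hρlo]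
    exact ciInf_le ⟨0, by rintro _ ⟨j, rfl⟩; exact hρnonneg j⟩ k
  obtain ⟨r, hr⟩ := hρbdd
  replace hr : ∀ k, ρ k ≤ r := fun k => hr (Set.mem_range_self k)
  have hhf : CGALP.dom h ⊆ CGALP.dom f := hsmooth.2.2.1
  have hhg : CGALP.dom h ⊆ CGALP.dom fun x => g (T x) := fun v hv =>
    hg.mem_dom_of_mem_subdiff (hsub ⟨v, hv, rfl⟩).some_mem
  have hfd : ∀ w ∈ CGALP.dom h, DifferentiableAt ℝ (fun y => (f y).toReal) w := by
    obtain ⟨-, -, -, -, C₀, -, hC, -, -, -, hd, -⟩ := hsmooth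
    exact fun w hw => hd w (hC hw)
  obtain ⟨R, hR⟩ := CGALP.isBounded_of_isCompact_weak hcompact
  obtain ⟨K, hK⟩ := hsmooth.descent hh.convex_dom
  obtain ⟨M, hM⟩ := hsubbdd
  have hxC := hrun.x_mem hh hγ
  have hsC := hrun.s_mem hh
  have hsel : ∀ k, ∃ u ∈ CGALP.subdiff g (T (x k)), ‖u‖ ≤ M := fun k => by
    obtain ⟨u, hu⟩ := hg.exists_isMinNormSelection (hsub ⟨x k, hxC k, rfl⟩)
    exact ⟨u, hu.1, hM _ (hxC k) u hu⟩
  have hprox : ∀ k, ‖(β k)⁻¹ • (T (x k) - y k)‖ ≤ M := fun k => by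
    obtain ⟨u, hu, huM⟩ := hsel k
    exact (hg.norm_prox_le (hβpos k) (hrun.y_step k) hu).trans huM
  have hdiam : ∀ v ∈ CGALP.dom h, ∀ w ∈ CGALP.dom h, ‖v - w‖ ≤ 2 * R := fun v hv w hw =>
    (norm_sub_le v w).trans (by linarith [hR v hv, hR w hw])
  -- Each summand has an affine minorant, bounded below on the bounded set `dom h`; the one for `h`
  -- comes from the optimality of `s 0`.
  obtain ⟨m, hm⟩ : ∃ m, ∀ w ∈ CGALP.dom h,
      m ≤ (f w).toReal + (g (T w)).toReal + (h w).toReal := by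
    obtain ⟨u, hu, -⟩ := hsel 0
    refine ⟨(f (x 0)).toReal - ‖CGALP.grad f (x 0)‖ * (2 * R) +
      ((g (T (x 0))).toReal - ‖u‖ * (‖T‖ * (2 * R))) +
      ((h (s 0)).toReal + ⟪z 0, s 0 - x 0⟫ - ‖z 0‖ * (2 * R)), fun w hw => ?_⟩
    have hb : ∀ v : Hp, |⟪v, w - x 0⟫| ≤ ‖v‖ * (2 * R) := fun v =>
      (abs_real_inner_le_norm _ _).trans
        (mul_le_mul_of_nonneg_left (hdiam w hw _ (hxC 0)) (norm_nonneg _))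
    have h1 := hf.inner_grad_le (hhf (hxC 0)) (hhf hw) (hfd _ (hxC 0))
    have h2 := (hg.mem_subdiff_iff (hg.mem_dom_of_mem_subdiff hu)).1 hu (T w) (hhg hw)
    have h3 := hrun.s_step_real hh 0 hw
    have h4 : |⟪u, T w - T (x 0)⟫| ≤ ‖u‖ * (‖T‖ * (2 * R)) := by
      rw [← map_sub]
      refine (abs_real_inner_le_norm _ _).trans
        (mul_le_mul_of_nonneg_left ((T.le_opNorm _).trans ?_) (norm_nonneg _))
      exact mul_le_mul_of_nonneg_left (hdiam w hw _ (hxC 0)) (norm_nonneg _)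
    linarith [(abs_le.1 (hb (CGALP.grad f (x 0)))).1, (abs_le.1 (hb (z 0))).2,
      (abs_le.1 h4).1]
  have hβ0 : ∀ k, β k ≤ β 0 := fun k => hβanti (Nat.zero_le k)
  have hγ2 : Summable fun k => γ k ^ 2 := by
    refine Summable.of_nonneg_of_le (fun k => sq_nonneg _) (fun k => ?_) (hγsq.mul_left (β 0))
    rw [← mul_div_assoc, le_div_iff₀ (hβpos k), mul_comm]
    exact mul_le_mul_of_nonneg_right (hβ0 k) (sq_nonneg _)
  have hβdiff : Summable fun k => β k - β (k + 1) := by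
    have := CGALP.summable_sub_succ_of_tendsto (u := fun k => -β k) hβlim.neg hβanti.neg
    refine this.congr fun k => ?_
    ring
  obtain ⟨B, hB⟩ := CGALP.exists_lower_bound_augmented_lagrangian
    (C := CGALP.dom h) (Ψ := fun w => (f w).toReal + (g (T w)).toReal + (h w).toReal)
    (q := fun w => A w - b) (R := ‖A‖ * R + ‖b‖) (m := m)
    (x := x) (μ := μ)
    (p := fun k => (f (x k)).toReal + CGALP.moreau g (β k) (T (x k)) (y k) + (h (x k)).toReal)
    (γ := γ) (θ := θ) (ρ := ρ) (η := fun k => β k * (M ^ 2 / 2))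
    (ε := fun k => K * ζ (γ k) + γ k ^ 2 / β k * ((‖T‖ * (2 * R)) ^ 2 / 2) +
      γ k ^ 2 * (r * (‖A‖ * (2 * R)) ^ 2 / 2) + (β k - β (k + 1)) * (M ^ 2 / 2))
    (N := β 0 * (M ^ 2 / 2))
    (fun w hw => (norm_sub_le _ _).trans (add_le_add_left ((A.le_opNorm _).trans
      (mul_le_mul_of_nonneg_left (hR w hw) (norm_nonneg _))) _))
    hm hxC hγ hρnonneg hρmono ⟨r, by rintro _ ⟨k, rfl⟩; exact hr k⟩
    (fun k => by rw [hθ]; exact (div_pos (hγ k).1 hc).le)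
    -- Short dual steps: `γ k / c ≤ γhi / c * γ (k + 1)`, and `γhi / c` is below `ρ (k + 1) / 2`.
    (fun k => by
      have h1 := hγratio_hi k
      rw [div_le_iff₀ (hγ (k + 1)).1] at h1
      rw [hθ, div_le_iff₀ hc]
      have h2 : γhi ≤ ρ (k + 1) / 2 * c := by
        rw [← div_le_iff₀ hc]
        linarith [hρge (k + 1)]
      have h3 := mul_le_mul_of_nonneg_right h2 (hγ (k + 1)).1.le
      linarith)
    ((((hζγ.mul_left K).add (hγsq.mul_right _)).add (hγ2.mul_right _)).add (hβdiff.mul_right _))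
    ((hγβ.mul_right (M ^ 2 / 2)).congr fun k => mul_assoc _ _ _)
    (fun k => mul_le_mul_of_nonneg_right (hβ0 k) (by positivity))
    hrun.μ_step
    (fun k => by
      obtain ⟨u, hu, huM⟩ := hsel k
      have h1 := hg.le_moreau_add (hβpos k) (hrun.y_step k) hu
      have h2 : β k * (‖u‖ ^ 2 / 2) ≤ β k * (M ^ 2 / 2) := by
        have := (hβpos k).le
        gcongr
      linarith)
    (fun k w hw => hrun.augmented_lagrangian_step hg hf hh hfd hhf hhg hγ hβpos hρnonneg
      (hβanti k.le_succ) (hr k) (hK _ (hxC k) _ (hsC k) _ (hγ k)) (hprox (k + 1))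
      (hdiam _ (hsC k) _ (hxC k)) hw)
  obtain ⟨hbA, hdir⟩ := CGALP.exists_feasible_direction hhg hqual
  refine CGALP.isBounded_range_of_inner_le (S := A.range) hrange (hrun.μ_mem hbA)
    fun w hw => ?_
  obtain ⟨v, hv, t, ht, hvw⟩ := hdir w hw
  -- Solve the bound at `v` for `⟪μ k, w⟫`, with `ρ k` replaced by its upper bound `r`.
  refine ⟨(B + ((f v).toReal + (g (T v)).toReal + (h v).toReal) + r / 2 * ‖A v - b‖ ^ 2) / t,
    fun k => ?_⟩
  have h1 := hB k v hv
  have h2 := mul_le_mul_of_nonneg_right (hr k) (sq_nonneg ‖A v - b‖)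
  have h3 : ⟪μ k, A v - b⟫ = t * ⟪μ k, w⟫ := by rw [hvw, real_inner_smul_right]
  rw [← neg_div, div_le_iff₀ ht]
  linarith
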